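/- Let $1\le a\le b$ be integers, $r=a+b$, and let $S_{a,b}=\mathbb P(\mathcal O_{\mathbb P^1}(a)\oplus\mathcal O_{\mathbb P^1}(b))\subset\mathbb P^{r+1}$ be the complex rational normal scroll of degree $r$, embedded by the complete linear system $|\mathcal O(1)|$; explicitly, it is the set of points $$[us^a:us^{a-1}t:\cdots:ut^a:vs^b:vs^{b-1}t:\cdots:vt^b],\qquad (s,t),(u,v)\in\mathbb C^2\setminus\{0\}.$$ Let $S_{a,b}[2]$ be the Hilbert scheme of $0$-dimensional subschemes of length $2$ of $S_{a,b}$, and let $X_{a,b}\subset\mathbb G(1,r+1)$ be the image of the secant map, which sends $\mathfrak y\in S_{a,b}[2]$ to the line $\langle\mathfrak y\rangle\subset\mathbb P^{r+1}$ that it spans; that is, $X_{a,b}$ consists of all lines that are secant or tangent to $S_{a,b}$. Regard $X_{a,b}$ as a (reduced) subvariety of $\mathbb P^{r(r+3)/2}$ through the Pl\"ucker embedding of $\mathbb G(1,r+1)$, the Pl\"ucker space having dimension $\binom{r+2}{2}-1=r(r+3)/2$. Then $X_{a,b}$ spans $\mathbb P^{r(r+3)/2}$ and is linearly normal there: it is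 contained in no hyperplane, and every global section of $\mathcal O_{X_{a,b}}(1)$ is the restriction of a linear form on $\mathbb P^{r(r+3)/2}$. -/

import Mathlib

/-- The vector of `ℂ^(a+b+2)` with coordinates
`(u s^a, u s^(a-1) t, …, u t^a, v s^b, v s^(b-1) t, …, v t^b)`. -/
def scrollVec (a b : ℕ) (s t u v : ℂ) : Fin (a + b + 2) → ℂ := fun i =>
  if (i : ℕ) ≤ a then u * s ^ (a - (i : ℕ)) * t ^ (i : ℕ)
  else v * s ^ (a + b + 1 - (i : ℕ)) * t ^ ((i : ℕ) - (a + 1))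

/-- The affine cone over the rational normal scroll `S_{a,b} ⊆ ℙ^(a+b+1)`, the image of
`ℙ(𝒪(a) ⊕ 𝒪(b))` under the complete linear system `|𝒪(1)|`. -/
def scrollCone (a b : ℕ) : Set (Fin (a + b + 2) → ℂ) :=
  {p | ∃ s t u v : ℂ, p = scrollVec a b s t u v}

/-- A closed subscheme of length two of the scroll `S_{a,b} ⊆ ℙ^(a+b+1)`, that is, a point of the
Hilbert scheme `S_{a,b}[2]`.  Such a scheme is `Spec A` with `A` a commutative `ℂ`-algebra of
dimension two.  Since line bundles on `Spec A` are trivial, a morphism `Spec A ⟶ ℙ^(a+b+1)` is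
given by homogeneous coordinates `x_i ∈ A` which generate the unit ideal.  It is a closed
immersion if and only if the `x_i` span `A` as a vector space (otherwise they span a line, so that
the morphism is constant), and it factors through `S_{a,b}` if and only if all the polynomials
that vanish on (the cone over) `S_{a,b}` vanish at `x`. -/
structure LengthTwoSubscheme (a b : ℕ) where
  /-- the coordinate ring `A` -/
  A : Type
  [commRing : CommRing A]
  [algebra : Algebra ℂ A]
  finrank_eq_two : Module.finrank ℂ A = 2
  /-- the homogeneous coordinates `x_i` -/
  x : Fin (a + b + 2) → A
  span_x : Submodule.span ℂ (Set.range x) = ⊤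
  vanishing : ∀ F : MvPolynomial (Fin (a + b + 2)) ℂ,
    (∀ p ∈ scrollCone a b, MvPolynomial.eval p F = 0) → MvPolynomial.aeval x F = 0

attribute [instance] LengthTwoSubscheme.commRing LengthTwoSubscheme.algebra

/-- The line `⟨y⟩` spanned by a length two subscheme `y` (as a linear subspace of `ℂ^(a+b+2)`):
the common zeros of all linear forms that vanish on `y`. -/
def LengthTwoSubscheme.line {a b : ℕ} (y : LengthTwoSubscheme a b) :
    Submodule ℂ (Fin (a + b + 2) → ℂ) where
  carrier := {w | ∀ c : Fin (a + b + 2) → ℂ, ∑ i, c i • y.x i = 0 → ∑ i, c i * w i = 0}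
  add_mem' := by
    intro w w' h h' c hc
    simp only [Pi.add_apply, mul_add, Finset.sum_add_distrib, h c hc, h' c hc, add_zero]
  zero_mem' := by
    intro c _
    simp
  smul_mem' := by
    intro k w h c hc
    simp only [Pi.smul_apply, smul_eq_mul, mul_left_comm _ k, ← Finset.mul_sum, h c hc, mul_zero]

/-- The index set of the Plücker coordinates of lines in `ℙ^(n-1)`: pairs `i < j`. -/
abbrev PluckerIndex (n : ℕ) : Type := {ij : Fin n × Fin n // ij.1 < ij.2}

/-- The Plücker coordinates `p_i q_j - p_j q_i` (`i < j`) of the line through `p` and `q`. -/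
def pluckerVec {n : ℕ} (p q : Fin n → ℂ) : PluckerIndex n → ℂ := fun ij =>
  p ij.1.1 * q ij.1.2 - p ij.1.2 * q ij.1.1

/-- The secant variety `X_{a,b}` in the Plücker space: the image of the secant map
`S_{a,b}[2] ⟶ 𝔾(1, a+b+1) ⊆ ℙ(ℂ^(PluckerIndex (a+b+2)))`, which sends a length two subscheme to
the line that it spans. -/
def secantVariety (a b : ℕ) : Set (Projectivization ℂ (PluckerIndex (a + b + 2) → ℂ)) :=
  {P | ∃ (y : LengthTwoSubscheme a b) (p q : Fin (a + b + 2) → ℂ) (h : pluckerVec p q ≠ 0),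
    y.line = Submodule.span ℂ {p, q} ∧ P = Projectivization.mk ℂ (pluckerVec p q) h}

/-- The affine cone without the origin over a subset of projective space. -/
def puncturedCone {κ : Type*} (X : Set (Projectivization ℂ (κ → ℂ))) : Set (κ → ℂ) :=
  {w | ∃ h : w ≠ 0, Projectivization.mk ℂ w h ∈ X}

/-- `f` is a global section of `𝒪_X(1)`, for a closed subvariety `X` of projective space (with its
reduced structure): a function on the punctured cone over `X` which is locally a quotient `F / G`
of homogeneous polynomials with `deg F = deg G + 1`.  (The values of `f` off the cone are
irrelevant.  The neighbourhood may be taken to be the locus `G ≠ 0`.) -/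
def IsGlobalSectionO1 {κ : Type*} (X : Set (Projectivization ℂ (κ → ℂ))) (f : (κ → ℂ) → ℂ) :
    Prop :=
  ∀ w ∈ puncturedCone X, ∃ (d : ℕ) (F G : MvPolynomial κ ℂ),
    F.IsHomogeneous (d + 1) ∧ G.IsHomogeneous d ∧ MvPolynomial.eval w G ≠ 0 ∧
    ∀ w' ∈ puncturedCone X, MvPolynomial.eval w' G ≠ 0 →
      f w' = MvPolynomial.eval w' F / MvPolynomial.eval w' G

/-- `X` is linearly normal: it is embedded by a complete linear system, that is, every global
section of `𝒪_X(1)` is the restriction of a linear form of the ambient space. -/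
def IsLinearlyNormal {κ : Type*} (X : Set (Projectivization ℂ (κ → ℂ))) : Prop :=
  ∀ f : (κ → ℂ) → ℂ, IsGlobalSectionO1 X f →
    ∃ l : (κ → ℂ) →ₗ[ℂ] ℂ, ∀ w ∈ puncturedCone X, f w = l w

/-! Let `f` be a section of 𝒪(1) on the secant variety and fix a point q of the scroll lying on
neither directrix u = 0, v = 0. Then p ↦ f(p ∧ q) is regular wherever p ∧ q ≠ 0. Each directrix
avoids q, so there the function lives on all of ℙ¹ and is a binary form, of degree a on v = 0 and b
on u = 0. A ruling not through q also avoids q, so there the function is linear in (u, v). Together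
these make it a linear form in p off the ruling through q (`exists_linearMap_fixed_right`).

Since f(p ∧ q) = -f(q ∧ p), the function is linear in each variable. Interpolating at a basis of
points of the scroll gives one bilinear form valid for general p and q, and its antisymmetrization
is a linear form in p ∧ q (`exists_linearMap_generic`).

General secants are dense in the cone over the secant variety
(`puncturedCone_subset_closure_generic`): tangent vectors are velocities of curves on the scroll, so
tangent lines are limits of secants. The equality with the linear form passes to the closure
(`eq_of_mem_closure`). Neither cohomology nor normality of the secant variety enters.

Non-degeneracy is simpler: points of the scroll span the ambient space, hence their wedges span the
Plücker space. -/

open Filter Topology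

/-! ### Plücker vectors -/

/-- The Plücker map `(p, q) ↦ p ∧ q` as a bilinear map. -/
noncomputable def pluckerMap (n : ℕ) :
    (Fin n → ℂ) →ₗ[ℂ] (Fin n → ℂ) →ₗ[ℂ] (PluckerIndex n → ℂ) :=
  LinearMap.mk₂ ℂ pluckerVec
    (by intros; ext; simp only [pluckerVec, Pi.add_apply]; ring)
    (by intros; ext; simp only [pluckerVec, Pi.smul_apply, smul_eq_mul]; ring)
    (by intros; ext; simp only [pluckerVec, Pi.add_apply]; ring)
    (by intros; ext; simp only [pluckerVec, Pi.smul_apply, smul_eq_mul]; ring)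

@[simp]
theorem pluckerMap_apply {n : ℕ} (p q : Fin n → ℂ) : pluckerMap n p q = pluckerVec p q := rfl

theorem pluckerVec_self {n : ℕ} (p : Fin n → ℂ) : pluckerVec p p = 0 := by
  ext; simp only [pluckerVec, Pi.zero_apply]; ring

theorem pluckerVec_swap {n : ℕ} (p q : Fin n → ℂ) : pluckerVec q p = -pluckerVec p q := by
  ext; simp only [pluckerVec, Pi.neg_apply]; ring

theorem pluckerVec_zero_left {n : ℕ} (q : Fin n → ℂ) : pluckerVec 0 q = 0 := by
  ext; simp [pluckerVec]

theorem pluckerVec_smul_left {n : ℕ} (c : ℂ) (p q : Fin n → ℂ) :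
    pluckerVec (c • p) q = c • pluckerVec p q := by
  ext; simp only [pluckerVec, Pi.smul_apply, smul_eq_mul]; ring

theorem pluckerVec_smul_right {n : ℕ} (c : ℂ) (p q : Fin n → ℂ) :
    pluckerVec p (c • q) = c • pluckerVec p q := by
  ext; simp only [pluckerVec, Pi.smul_apply, smul_eq_mul]; ring

theorem pluckerVec_eq_zero_iff_minors {n : ℕ} (p q : Fin n → ℂ) :
    pluckerVec p q = 0 ↔ ∀ i j, p i * q j = p j * q i := by
  constructor
  · intro h i j
    rcases lt_trichotomy i j with hij | rfl | hij
    · simpa [pluckerVec, sub_eq_zero] using congrFun h ⟨(i, j), hij⟩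
    · rfl
    · have := congrFun h ⟨(j, i), hij⟩
      simp only [pluckerVec, Pi.zero_apply, sub_eq_zero] at this
      exact this.symm
  · intro h
    ext ij
    simp [pluckerVec, h ij.1.1 ij.1.2]

theorem pluckerVec_of_mem_span_pair {n : ℕ} {p₀ q₀ p q : Fin n → ℂ}
    (hp : p ∈ Submodule.span ℂ {p₀, q₀}) (hq : q ∈ Submodule.span ℂ {p₀, q₀}) :
    ∃ c : ℂ, pluckerVec p q = c • pluckerVec p₀ q₀ := by
  obtain ⟨x, y, rfl⟩ := Submodule.mem_span_pair.1 hp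
  obtain ⟨z, w, rfl⟩ := Submodule.mem_span_pair.1 hq
  refine ⟨x * w - y * z, ?_⟩
  ext
  simp only [pluckerVec, Pi.add_apply, Pi.smul_apply, smul_eq_mul]
  ring

theorem continuous_pluckerVec {n : ℕ} :
    Continuous fun x : (Fin n → ℂ) × (Fin n → ℂ) => pluckerVec x.1 x.2 := by
  unfold pluckerVec
  fun_prop

theorem linearMap_apply_eq_sum_single {n : ℕ} (φ : (Fin n → ℂ) →ₗ[ℂ] ℂ) (v : Fin n → ℂ) :
    φ v = ∑ i, φ (Pi.single i 1) * v i := by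
  rw [LinearMap.pi_apply_eq_sum_univ φ v]
  refine Finset.sum_congr rfl fun i _ => ?_
  rw [smul_eq_mul, mul_comm]
  congr 2
  ext j
  simp [Pi.single_apply, eq_comm]

theorem mem_span_pair_of_annihilated {n : ℕ} {p q w : Fin n → ℂ}
    (h : ∀ c : Fin n → ℂ, ∑ i, c i * p i = 0 → ∑ i, c i * q i = 0 → ∑ i, c i * w i = 0) :
    w ∈ Submodule.span ℂ {p, q} := by
  by_contra hw
  obtain ⟨φ, hφw, hφ⟩ := Submodule.exists_le_ker_of_notMem hw
  apply hφw
  rw [linearMap_apply_eq_sum_single]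
  apply h <;> rw [← linearMap_apply_eq_sum_single]
  · exact hφ (Submodule.subset_span (by simp))
  · exact hφ (Submodule.subset_span (by simp))

/-! ### Length two subschemes and the lines they span -/

/-- By independence of `e` and `f`, a linear form vanishes at `y.x` exactly when it vanishes at both
coefficient vectors `p` and `q`. -/
theorem LengthTwoSubscheme.line_eq_span {a b : ℕ} (y : LengthTwoSubscheme a b) (e f : y.A)
    (hef : ∀ c d : ℂ, c • e + d • f = 0 → c = 0 ∧ d = 0) (p q : Fin (a + b + 2) → ℂ)
    (hx : ∀ i, y.x i = p i • e + q i • f) : y.line = Submodule.span ℂ {p, q} := by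
  have key (c : Fin (a + b + 2) → ℂ) :
      ∑ i, c i • y.x i = (∑ i, c i * p i) • e + (∑ i, c i * q i) • f := by
    simp only [hx, smul_add, smul_smul, Finset.sum_add_distrib, Finset.sum_smul]
  apply le_antisymm
  · intro w hw
    apply mem_span_pair_of_annihilated
    intro c hp hq
    exact hw c (by rw [key, hp, hq]; simp)
  · rw [Submodule.span_le]
    rintro w (rfl | rfl) c hc
    · exact (hef _ _ ((key c).symm.trans hc)).1
    · exact (hef _ _ ((key c).symm.trans hc)).2

/-- The length two subscheme consisting of two distinct points of the scroll. -/
noncomputable def LengthTwoSubscheme.ofPoints {a b : ℕ} (p q : Fin (a + b + 2) → ℂ)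
    (hp : p ∈ scrollCone a b) (hq : q ∈ scrollCone a b) (h : pluckerVec p q ≠ 0) :
    LengthTwoSubscheme a b where
  A := ℂ × ℂ
  finrank_eq_two := by simp
  x i := (p i, q i)
  span_x := by
    have : ∃ i j, p i * q j - p j * q i ≠ 0 := by
      by_contra! hc
      exact h ((pluckerVec_eq_zero_iff_minors p q).2 fun i j => sub_eq_zero.1 (hc i j))
    obtain ⟨i, j, hij⟩ := this
    rw [eq_top_iff]
    rintro ⟨z, w⟩ -
    have hi := Submodule.subset_span (R := ℂ) (Set.mem_range_self (f := fun i => (p i, q i)) i)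
    have hj := Submodule.subset_span (R := ℂ) (Set.mem_range_self (f := fun i => (p i, q i)) j)
    convert add_mem
      (Submodule.smul_mem _ ((z * q j - w * p j) / (p i * q j - p j * q i)) hi)
      (Submodule.smul_mem _ ((w * p i - z * q i) / (p i * q j - p j * q i)) hj) using 1
    ext
    · simp only [Prod.smul_mk, smul_eq_mul, Prod.mk_add_mk]
      rw [div_mul_eq_mul_div, div_mul_eq_mul_div, ← add_div, eq_div_iff hij]
      ring
    · simp only [Prod.smul_mk, smul_eq_mul, Prod.mk_add_mk]
      rw [div_mul_eq_mul_div, div_mul_eq_mul_div, ← add_div, eq_div_iff hij]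
      ring
  vanishing F hF := by
    apply Prod.ext
    · have := MvPolynomial.comp_aeval_apply (f := fun i => (p i, q i)) (AlgHom.fst ℂ ℂ ℂ) F
      exact this.trans (hF p hp)
    · have := MvPolynomial.comp_aeval_apply (f := fun i => (p i, q i)) (AlgHom.snd ℂ ℂ ℂ) F
      exact this.trans (hF q hq)

theorem mk_pluckerVec_mem_secantVariety {a b : ℕ} {p q : Fin (a + b + 2) → ℂ}
    (hp : p ∈ scrollCone a b) (hq : q ∈ scrollCone a b) (h : pluckerVec p q ≠ 0) :
    Projectivization.mk ℂ (pluckerVec p q) h ∈ secantVariety a b := by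
  refine ⟨.ofPoints p q hp hq h, p, q, h, ?_, rfl⟩
  refine LengthTwoSubscheme.line_eq_span _ ((1, 0) : ℂ × ℂ) ((0, 1) : ℂ × ℂ) ?_ p q ?_
  · intro c d hcd
    have : c • ((1, 0) : ℂ × ℂ) + d • ((0, 1) : ℂ × ℂ) = 0 := hcd
    simpa [Prod.ext_iff] using this
  · intro i
    change (p i, q i) = p i • ((1, 0) : ℂ × ℂ) + q i • ((0, 1) : ℂ × ℂ)
    simp

theorem pluckerVec_mem_puncturedCone {a b : ℕ} {p q : Fin (a + b + 2) → ℂ}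
    (hp : p ∈ scrollCone a b) (hq : q ∈ scrollCone a b) (h : pluckerVec p q ≠ 0) :
    pluckerVec p q ∈ puncturedCone (secantVariety a b) :=
  ⟨h, mk_pluckerVec_mem_secantVariety hp hq h⟩

theorem smul_mem_puncturedCone {κ : Type*} {X : Set (Projectivization ℂ (κ → ℂ))} {w : κ → ℂ}
    (hw : w ∈ puncturedCone X) {c : ℂ} (hc : c ≠ 0) : c • w ∈ puncturedCone X := by
  obtain ⟨h, hX⟩ := hw
  refine ⟨smul_ne_zero hc h, ?_⟩
  convert hX using 1
  rw [Projectivization.mk_eq_mk_iff']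
  exact ⟨c, rfl⟩

/-- A two-dimensional commutative complex algebra is generated by an element with square `0`
or `1`. -/
theorem exists_basis_sq_of_finrank_eq_two {A : Type*} [CommRing A] [Algebra ℂ A]
    (hA : Module.finrank ℂ A = 2) :
    ∃ (e : A) (δ : ℂ), (δ = 0 ∨ δ = 1) ∧ e * e = δ • (1 : A) ∧
      (∀ c d : ℂ, c • (1 : A) + d • e = 0 → c = 0 ∧ d = 0) ∧
      ∀ z : A, ∃ c d : ℂ, z = c • (1 : A) + d • e := by
  have : Nontrivial A := Module.nontrivial_of_finrank_pos (R := ℂ) (by omega)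
  obtain ⟨e₀, he₀⟩ : ∃ e₀ : A, e₀ ∉ Submodule.span ℂ {(1 : A)} := by
    by_contra! h
    have h1 : Submodule.span ℂ {(1 : A)} = ⊤ := eq_top_iff.2 fun z _ => h z
    have h2 := finrank_span_singleton (K := ℂ) (one_ne_zero (α := A))
    rw [h1, finrank_top] at h2
    omega
  have hind (e : A) (he : e ∉ Submodule.span ℂ {(1 : A)}) :
      (∀ c d : ℂ, c • (1 : A) + d • e = 0 → c = 0 ∧ d = 0) := by
    intro c d h
    have hd : d = 0 := by
      by_contra hd
      apply he
      rw [Submodule.mem_span_singleton]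
      refine ⟨-(d⁻¹ * c), ?_⟩
      have : d⁻¹ • (c • (1 : A) + d • e) = 0 := by rw [h, smul_zero]
      rw [smul_add, smul_smul, smul_smul, inv_mul_cancel₀ hd, one_smul] at this
      rw [neg_smul, neg_eq_iff_add_eq_zero, this]
    subst hd
    simpa using h
  have hspan (e : A) (he : e ∉ Submodule.span ℂ {(1 : A)}) :
      ∀ z : A, ∃ c d : ℂ, z = c • (1 : A) + d • e := by
    intro z
    have hli : LinearIndependent ℂ ![(1 : A), e] :=
      LinearIndependent.pair_iff.2 (hind e he)
    have : z ∈ Submodule.span ℂ (Set.range ![(1 : A), e]) := by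
      rw [hli.span_eq_top_of_card_eq_finrank (by simp [hA])]
      trivial
    rw [Matrix.range_cons, Matrix.range_cons, Matrix.range_empty, Set.union_empty,
      Set.singleton_union, Submodule.mem_span_pair] at this
    obtain ⟨c, d, h⟩ := this
    exact ⟨c, d, h.symm⟩
  obtain ⟨α, β, hαβ⟩ := hspan e₀ he₀ (e₀ * e₀)
  -- Completing the square in e₀² = α + β e₀: the element e₀ - β/2 has square α + β²/4 = η². If η ≠
  -- 0, dividing by η makes the square 1.
  obtain ⟨η, hη⟩ := IsAlgClosed.exists_pow_nat_eq (α + β ^ 2 / 4) (n := 2) (by norm_num)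
  have shift (c : ℂ) (d : ℂ) (hd : d ≠ 0) : d • (e₀ - c • 1) ∉ Submodule.span ℂ {(1 : A)} := by
    intro h
    apply he₀
    have h2 := Submodule.smul_mem _ d⁻¹ h
    rw [smul_smul, inv_mul_cancel₀ hd, one_smul] at h2
    simpa using add_mem h2 (Submodule.smul_mem _ c (Submodule.mem_span_singleton_self (1 : A)))
  have hsq (d : ℂ) : (d • (e₀ - (β / 2) • (1 : A))) * (d • (e₀ - (β / 2) • (1 : A))) =
      (d ^ 2 * η ^ 2) • (1 : A) := by
    have : (e₀ - (β / 2) • (1 : A)) * (e₀ - (β / 2) • (1 : A)) = η ^ 2 • (1 : A) := by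
      rw [hη]
      simp only [Algebra.smul_def, mul_one] at hαβ ⊢
      have h2 : algebraMap ℂ A β = algebraMap ℂ A (β / 2) + algebraMap ℂ A (β / 2) := by
        rw [← map_add, add_halves]
      have h4 : algebraMap ℂ A (α + β ^ 2 / 4) = algebraMap ℂ A α +
          algebraMap ℂ A (β / 2) * algebraMap ℂ A (β / 2) := by
        rw [← map_mul, ← map_add]
        congr 1
        ring
      rw [h4]
      linear_combination hαβ + h2 * e₀
    rw [smul_mul_smul_comm, this, smul_smul]
    congr 1
    ring
  by_cases h0 : η = 0
  · have := shift (β / 2) 1 one_ne_zero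
    exact ⟨_, 0, Or.inl rfl, by rw [hsq, h0]; simp, hind _ this, hspan _ this⟩
  · have := shift (β / 2) η⁻¹ (inv_ne_zero h0)
    exact ⟨_, 1, Or.inr rfl, by rw [hsq]; field_simp, hind _ this, hspan _ this⟩

/-! ### Determinantal equations of the scroll and its tangent vectors -/

/-- The common factor of the column `k` of the `2 × (a + b)` matrix
`(x_0 … x_(a-1) x_(a+1) … x_(a+b); x_1 … x_a x_(a+2) … x_(a+b+1))` at a point of the scroll. -/
def scrollFactor (a b : ℕ) (s t u v : ℂ) (k : Fin (a + b + 1)) : ℂ :=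
  if (k : ℕ) < a then u * s ^ (a - 1 - (k : ℕ)) * t ^ (k : ℕ)
  else v * s ^ (a + b - (k : ℕ)) * t ^ ((k : ℕ) - (a + 1))

theorem scrollVec_castSucc {a b : ℕ} (s t u v : ℂ) {k : Fin (a + b + 1)} (hk : (k : ℕ) ≠ a) :
    scrollVec a b s t u v k.castSucc = s * scrollFactor a b s t u v k := by
  have := k.2
  simp only [scrollVec, scrollFactor, Fin.val_castSucc]
  split_ifs
  · rw [show a - (k : ℕ) = a - 1 - k + 1 by omega]; ring
  · omega
  · omega
  · rw [show a + b + 1 - (k : ℕ) = a + b - k + 1 by omega]; ring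

theorem scrollVec_succ {a b : ℕ} (s t u v : ℂ) {k : Fin (a + b + 1)} (hk : (k : ℕ) ≠ a) :
    scrollVec a b s t u v k.succ = t * scrollFactor a b s t u v k := by
  have := k.2
  simp only [scrollVec, scrollFactor, Fin.val_succ]
  split_ifs
  · rw [show a - ((k : ℕ) + 1) = a - 1 - k by omega]; ring
  · omega
  · omega
  · rw [show a + b + 1 - ((k : ℕ) + 1) = a + b - k by omega,
      show (k : ℕ) + 1 - (a + 1) = k - (a + 1) + 1 by omega]; ring

theorem scrollVec_mem_scrollCone {a b : ℕ} (s t u v : ℂ) :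
    scrollVec a b s t u v ∈ scrollCone a b := ⟨s, t, u, v, rfl⟩

theorem scrollVec_smul {a b : ℕ} (c s t u v : ℂ) :
    scrollVec a b s t (c * u) (c * v) = c • scrollVec a b s t u v := by
  ext i
  simp only [scrollVec, Pi.smul_apply, smul_eq_mul]
  split_ifs <;> ring

theorem scrollVec_add {a b : ℕ} (s t u v u' v' : ℂ) :
    scrollVec a b s t (u + u') (v + v') = scrollVec a b s t u v + scrollVec a b s t u' v' := by
  ext i
  simp only [scrollVec, Pi.add_apply]
  split_ifs <;> ring

theorem smul_mem_scrollCone {a b : ℕ} (c : ℂ) {p : Fin (a + b + 2) → ℂ}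
    (hp : p ∈ scrollCone a b) : c • p ∈ scrollCone a b := by
  obtain ⟨s, t, u, v, rfl⟩ := hp
  rw [← scrollVec_smul]
  exact scrollVec_mem_scrollCone ..

theorem scrollVec_eq_scrollVec_one {a b : ℕ} {s : ℂ} (hs : s ≠ 0) (t u v : ℂ) :
    scrollVec a b s t u v = scrollVec a b 1 (t / s) (u * s ^ a) (v * s ^ b) := by
  ext i
  have := i.2
  simp only [scrollVec, one_pow, mul_one, div_pow]
  split_ifs with h
  · have : s ^ a = s ^ (a - i) * s ^ (i : ℕ) := by rw [← pow_add, Nat.sub_add_cancel h]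
    rw [this]
    field_simp
  · have hb : b = (a + b + 1 - i) + (i - (a + 1)) := by omega
    have : s ^ b = s ^ (a + b + 1 - i) * s ^ ((i : ℕ) - (a + 1)) := by rw [← pow_add, ← hb]
    rw [this]
    field_simp

theorem continuous_scrollVec (a b : ℕ) :
    Continuous fun x : ℂ × ℂ × ℂ × ℂ => scrollVec a b x.1 x.2.1 x.2.2.1 x.2.2.2 := by
  refine continuous_pi fun i => ?_
  unfold scrollVec
  split_ifs <;> fun_prop

/-- A vector is a point of the scroll with parameter `(s : t)` as soon as all columns of its
matrix are proportional to `(s, t)`. -/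
theorem exists_eq_scrollVec {a b : ℕ} {s t : ℂ} (hst : s ≠ 0 ∨ t ≠ 0) (x : Fin (a + b + 2) → ℂ)
    (hx : ∀ k : Fin (a + b + 1), (k : ℕ) ≠ a → t * x k.castSucc = s * x k.succ) :
    ∃ u v, x = scrollVec a b s t u v := by
  by_cases hs : s = 0
  · have ht : t ≠ 0 := by simpa [hs] using hst
    subst hs
    have h0 (k : Fin (a + b + 1)) (hk : (k : ℕ) ≠ a) : x k.castSucc = 0 := by
      simpa [ht] using hx k hk
    refine ⟨x ⟨a, by omega⟩ / t ^ a, x ⟨a + b + 1, by omega⟩ / t ^ b, ?_⟩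
    ext i
    have hi := i.2
    simp only [scrollVec]
    split_ifs with h
    · rcases h.eq_or_lt with h | h
      · have : i = ⟨a, by omega⟩ := Fin.ext h
        rw [← this, h]
        simp [ht]
      · rw [zero_pow (by omega)]
        rw [mul_zero, zero_mul]
        exact h0 ⟨i, by omega⟩ h.ne
    · rcases (Nat.le_of_lt_succ hi).eq_or_lt with h | h
      · have : i = ⟨a + b + 1, by omega⟩ := Fin.ext h
        rw [← this, h, show a + b + 1 - (a + 1) = b by omega]
        simp [ht]
      · rw [zero_pow (by omega)]
        rw [mul_zero, zero_mul]
        exact h0 ⟨i, by omega⟩ (by simp; omega)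
  · refine ⟨x ⟨0, by omega⟩ / s ^ a, x ⟨a + 1, by omega⟩ / s ^ b, ?_⟩
    have key1 (n : ℕ) (hn : n ≤ a) : s ^ n * x ⟨n, by omega⟩ = t ^ n * x ⟨0, by omega⟩ := by
      induction n with
      | zero => simp
      | succ n ih =>
        have h1 := hx ⟨n, by omega⟩ (by simp; omega)
        simp only [Fin.castSucc_mk, Fin.succ_mk] at h1
        have h2 := ih (by omega)
        linear_combination t * h2 - s ^ n * h1
    have key2 (n : ℕ) (hn : n < b + 1) :
        s ^ n * x ⟨a + 1 + n, by omega⟩ = t ^ n * x ⟨a + 1, by omega⟩ := by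
      induction n with
      | zero => simp
      | succ n ih =>
        have h1 := hx ⟨a + 1 + n, by omega⟩ (by simp; omega)
        simp only [Fin.castSucc_mk, Fin.succ_mk] at h1
        have h2 := ih (by omega)
        have h3 : x ⟨a + 1 + (n + 1), by omega⟩ = x ⟨a + 1 + n + 1, by omega⟩ := rfl
        rw [h3]
        linear_combination t * h2 - s ^ n * h1
    ext i
    have hi := i.2
    simp only [scrollVec]
    split_ifs with h
    · have h1 := key1 i h
      have h2 : s ^ a = s ^ (a - i) * s ^ (i : ℕ) := by rw [← pow_add]; congr 1; omega
      rw [h2]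
      field_simp
      linear_combination h1
    · obtain ⟨n, hn⟩ : ∃ n, (i : ℕ) = a + 1 + n := ⟨i - (a + 1), by omega⟩
      have h1 := key2 n (by omega)
      have h3 : i = ⟨a + 1 + n, by omega⟩ := Fin.ext hn
      have h2 : s ^ b = s ^ (a + b + 1 - i) * s ^ n := by rw [← pow_add]; congr 1; omega
      rw [h2, hn, Nat.add_sub_cancel_left, ← hn]
      field_simp
      rw [← h3] at h1
      linear_combination h1

/-- The scroll is cut out by the `2 × 2` minors of its matrix. -/
theorem mem_scrollCone_of_minors {a b : ℕ} (x : Fin (a + b + 2) → ℂ)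
    (hx : ∀ k l : Fin (a + b + 1), (k : ℕ) ≠ a → (l : ℕ) ≠ a →
      x k.castSucc * x l.succ = x k.succ * x l.castSucc) : x ∈ scrollCone a b := by
  by_cases h : ∃ k : Fin (a + b + 1), (k : ℕ) ≠ a ∧ x k.castSucc ≠ 0
  · obtain ⟨k, hk, hxk⟩ := h
    obtain ⟨u, v, h⟩ := exists_eq_scrollVec (s := x k.castSucc) (t := x k.succ) (Or.inl hxk) x
      -- The parameter (s : t) is read off a column with non-zero top entry. If there is none, the
      -- parameter is (0 : 1).
      fun l hl => (hx k l hk hl).symm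
    exact ⟨_, _, u, v, h⟩
  · push Not at h
    obtain ⟨u, v, h⟩ := exists_eq_scrollVec (s := 0) (t := 1) (Or.inr one_ne_zero) x
      fun l hl => by simp [h l hl]
    exact ⟨_, _, u, v, h⟩

/-- Every vector tangent to the equations of the scroll at a nonzero point is the velocity of a
curve on the scroll. -/
theorem exists_hasDerivAt_of_linearized_minors {a b : ℕ} (ha : 1 ≤ a) (hb : 1 ≤ b)
    {p q : Fin (a + b + 2) → ℂ} (hp0 : p ≠ 0) (hp : p ∈ scrollCone a b)
    (hq : ∀ k l : Fin (a + b + 1), (k : ℕ) ≠ a → (l : ℕ) ≠ a →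
      p k.castSucc * q l.succ + q k.castSucc * p l.succ =
        p k.succ * q l.castSucc + q k.succ * p l.castSucc) :
    ∃ γ : ℂ → Fin (a + b + 2) → ℂ, (∀ ε, γ ε ∈ scrollCone a b) ∧ γ 0 = p ∧ HasDerivAt γ q 0 := by
  obtain ⟨s, t, u, v, rfl⟩ := hp
  have hst : s ≠ 0 ∨ t ≠ 0 := by
    by_contra! h
    apply hp0
    ext i
    have := i.2
    simp only [scrollVec, h.1, h.2, Pi.zero_apply]
    split_ifs with hi
    · by_cases h0 : (i : ℕ) = 0
      · rw [zero_pow (n := a - i) (by omega)]; simp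
      · rw [zero_pow h0]; simp
    · by_cases h0 : (i : ℕ) = a + 1
      · rw [zero_pow (n := a + b + 1 - i) (by omega)]; simp
      · rw [zero_pow (n := i - (a + 1)) (by omega)]; simp
  set m := scrollFactor a b s t u v with hm
  obtain ⟨l, hl, hml⟩ : ∃ l : Fin (a + b + 1), (l : ℕ) ≠ a ∧ m l ≠ 0 := by
    by_contra! h
    apply hp0
    ext i
    have hi := i.2
    -- The last coordinate of each block occurs only as the bottom entry of a column; every other
    -- coordinate is a top entry.
    by_cases hia : (i : ℕ) = a ∨ (i : ℕ) = a + b + 1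
    · have h1 := scrollVec_succ (a := a) (b := b) s t u v (k := ⟨i - 1, by omega⟩) (by simp; omega)
      rw [← hm, h ⟨i - 1, by omega⟩ (by simp; omega)] at h1
      convert h1 using 2
      · ext; simp; omega
      · simp
    · push Not at hia
      have h1 := scrollVec_castSucc (a := a) (b := b) s t u v (k := ⟨i, by omega⟩) hia.1
      rw [← hm, h ⟨i, by omega⟩ hia.1] at h1
      exact h1.trans (mul_zero _)
  -- With columns m_k (s, t), the linearized minors read m_l (t q_k - s q_{k+1}) = m_k (t q_l - s
  -- q_{l+1}), so these determinants are proportional to `m`.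
  obtain ⟨κ, hκ⟩ : ∃ κ : ℂ, ∀ k : Fin (a + b + 1), (k : ℕ) ≠ a →
      t * q k.castSucc - s * q k.succ = κ * m k := by
    refine ⟨(t * q l.castSucc - s * q l.succ) / m l, fun k hk => ?_⟩
    have h1 := hq k l hk hl
    rw [scrollVec_castSucc _ _ _ _ hk, scrollVec_succ _ _ _ _ hk, scrollVec_castSucc _ _ _ _ hl,
      scrollVec_succ _ _ _ _ hl, ← hm] at h1
    field_simp
    linear_combination h1
  -- Moving (s, t) in the direction (σ, τ) produces a velocity `D` with the same determinants κ m_k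
  -- as `q`.
  obtain ⟨σ, τ, hστ⟩ : ∃ σ τ : ℂ, t * σ - s * τ = κ := by
    rcases hst with h | h
    · exact ⟨0, -κ / s, by field_simp; ring⟩
    · exact ⟨κ / t, 0, by field_simp; ring⟩
  have hdiff (u v : ℂ) :
      DifferentiableAt ℂ (fun ε : ℂ => scrollVec a b (s + ε * σ) (t + ε * τ) u v) 0 := by
    rw [differentiableAt_pi]
    intro i
    unfold scrollVec
    split_ifs <;> fun_prop
  obtain ⟨D, hD⟩ : ∃ D, HasDerivAt (fun ε : ℂ => scrollVec a b (s + ε * σ) (t + ε * τ) u v) D 0 :=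
    ⟨_, (hdiff u v).hasDerivAt⟩
  have hs' : HasDerivAt (fun ε : ℂ => s + ε * σ) σ 0 := by
    simpa using ((hasDerivAt_id (0 : ℂ)).mul_const σ).const_add s
  have ht' : HasDerivAt (fun ε : ℂ => t + ε * τ) τ 0 := by
    simpa using ((hasDerivAt_id (0 : ℂ)).mul_const τ).const_add t
  have hDk (k : Fin (a + b + 1)) (hk : (k : ℕ) ≠ a) :
      t * D k.castSucc - s * D k.succ = κ * m k := by
    have h1 := ht'.mul ((hasDerivAt_pi.1 hD) k.castSucc)
    have h2 := hs'.mul ((hasDerivAt_pi.1 hD) k.succ)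
    have h3 := h1.unique (h2.congr_of_eventuallyEq (Eventually.of_forall fun ε => by
      simp only [Pi.mul_apply]
      rw [scrollVec_castSucc _ _ _ _ hk, scrollVec_succ _ _ _ _ hk]
      ring))
    simp only [zero_mul, add_zero] at h3
    rw [scrollVec_castSucc _ _ _ _ hk, scrollVec_succ _ _ _ _ hk, ← hm] at h3
    rw [← hστ]
    linear_combination h3
  -- The determinants of q - D vanish, so q - D lies in the plane of the ruling (s : t) and is
  -- absorbed by moving (u, v) linearly.
  obtain ⟨u', v', huv⟩ := exists_eq_scrollVec hst (q - D) fun k hk => by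
    simp only [Pi.sub_apply]
    linear_combination hκ k hk - hDk k hk
  refine ⟨fun ε => scrollVec a b (s + ε * σ) (t + ε * τ) (u + ε * u') (v + ε * v'),
    fun ε => scrollVec_mem_scrollCone .., by simp, ?_⟩
  have h1 := hD.add ((hasDerivAt_id (0 : ℂ)).smul (hdiff u' v').hasDerivAt)
  simp only [id, zero_smul, zero_mul, add_zero, one_smul, zero_add, ← huv,
    add_sub_cancel] at h1
  refine h1.congr_of_eventuallyEq (Eventually.of_forall fun ε => ?_)
  simp only [scrollVec_add, scrollVec_smul]
  rfl

/-! ### Density of general secants -/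

/-- A closed subscheme of length two of the scroll is a reduced pair of points or a tangent
direction; in both cases its Plücker vector is a limit of Plücker vectors of secants. -/
theorem LengthTwoSubscheme.pluckerVec_mem_closure {a b : ℕ} (ha : 1 ≤ a) (hb : 1 ≤ b)
    (y : LengthTwoSubscheme a b) {p q : Fin (a + b + 2) → ℂ} (hp : p ∈ y.line) (hq : q ∈ y.line)
    (hpq : pluckerVec p q ≠ 0) :
    pluckerVec p q ∈ closure {w | ∃ p ∈ scrollCone a b, ∃ q ∈ scrollCone a b,
      w = pluckerVec p q} := by
  obtain ⟨e, δ, hδ, hee, hind, hspan⟩ := exists_basis_sq_of_finrank_eq_two y.finrank_eq_two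
  choose p₀ q₀ hx using fun i => hspan (y.x i)
  have hline := y.line_eq_span 1 e hind p₀ q₀ hx
  rw [hline] at hp hq
  obtain ⟨c, hc⟩ := pluckerVec_of_mem_span_pair hp hq
  rw [hc] at hpq ⊢
  have hminors (k l : Fin (a + b + 1)) (hk : (k : ℕ) ≠ a) (hl : (l : ℕ) ≠ a) :
      y.x k.castSucc * y.x l.succ = y.x k.succ * y.x l.castSucc := by
    have := y.vanishing (MvPolynomial.X k.castSucc * MvPolynomial.X l.succ -
      MvPolynomial.X k.succ * MvPolynomial.X l.castSucc) (by
        rintro _ ⟨s, t, u, v, rfl⟩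
        simp only [map_sub, map_mul, MvPolynomial.eval_X]
        rw [scrollVec_castSucc _ _ _ _ hk, scrollVec_succ _ _ _ _ hk,
          scrollVec_castSucc _ _ _ _ hl, scrollVec_succ _ _ _ _ hl]
        ring)
    simpa [sub_eq_zero] using this
  have hmul (x₁ x₂ z w : ℂ) : (x₁ • (1 : y.A) + x₂ • e) * (z • (1 : y.A) + w • e) =
      (x₁ * z + δ * (x₂ * w)) • (1 : y.A) + (x₁ * w + x₂ * z) • e := by
    have : x₂ • e * w • e = (δ * (x₂ * w)) • (1 : y.A) := by
      rw [smul_mul_smul_comm, hee, smul_smul, mul_comm]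
    rw [add_mul, mul_add, mul_add, this]
    simp only [smul_mul_smul_comm, mul_one, one_mul, add_smul]
    abel
  have hcoef (k l : Fin (a + b + 1)) (hk : (k : ℕ) ≠ a) (hl : (l : ℕ) ≠ a) :
      p₀ k.castSucc * p₀ l.succ + δ * (q₀ k.castSucc * q₀ l.succ) =
        p₀ k.succ * p₀ l.castSucc + δ * (q₀ k.succ * q₀ l.castSucc) ∧
      p₀ k.castSucc * q₀ l.succ + q₀ k.castSucc * p₀ l.succ =
        p₀ k.succ * q₀ l.castSucc + q₀ k.succ * p₀ l.castSucc := by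
    have h1 := hminors k l hk hl
    rw [hx, hx, hx, hx, hmul, hmul, ← sub_eq_zero, add_sub_add_comm, ← sub_smul, ← sub_smul] at h1
    have h2 := hind _ _ h1
    exact ⟨sub_eq_zero.1 h2.1, sub_eq_zero.1 h2.2⟩
  rcases hδ with rfl | rfl
  · have hp₀ : p₀ ∈ scrollCone a b := mem_scrollCone_of_minors _ fun k l hk hl => by
      simpa using (hcoef k l hk hl).1
    have hp0 : p₀ ≠ 0 := by
      rintro rfl
      exact hpq (by rw [pluckerVec_zero_left, smul_zero])
    obtain ⟨γ, hγ, hγ0, hγ'⟩ := exists_hasDerivAt_of_linearized_minors ha hb hp0 hp₀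
      fun k l hk hl => (hcoef k l hk hl).2
    -- Case e² = 0: `q₀` is the velocity at `p₀` of a curve γ on the scroll. As p₀ ∧ p₀ = 0, wedging
    -- p₀ with the slope of γ equals p₀ ∧ ε⁻¹ γ(ε), a secant vector.
    rw [← pluckerVec_smul_left]
    have hslope := hasDerivAt_iff_tendsto_slope.1 hγ'
    have htend : Tendsto (fun ε => pluckerVec (c • p₀) (slope γ 0 ε)) (𝓝[≠] 0)
        (𝓝 (pluckerVec (c • p₀) q₀)) :=
      ((continuous_pluckerVec.comp (Continuous.prodMk_right (c • p₀))).tendsto q₀).comp hslope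
    refine mem_closure_of_tendsto htend (Eventually.of_forall fun ε =>
      ⟨c • p₀, smul_mem_scrollCone c hp₀, ε⁻¹ • γ ε, smul_mem_scrollCone _ (hγ ε), ?_⟩)
    rw [slope_def_module, hγ0, sub_zero, smul_sub, sub_eq_add_neg, ← pluckerMap_apply, map_add,
      map_neg, pluckerMap_apply, pluckerMap_apply, pluckerVec_smul_left c p₀ (ε⁻¹ • p₀),
      pluckerVec_smul_right ε⁻¹ p₀ p₀, pluckerVec_self]
    simp
  · apply subset_closure
    -- Case e² = 1: the two points are the values of p₀ + q₀ e at e = ±1. Since (p₀ + q₀) ∧ (p₀ -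
    -- q₀) = -2 p₀ ∧ q₀, the scaling factor is -c/2.
    have hsum (η : ℂ) (hη : η * η = 1) : p₀ + η • q₀ ∈ scrollCone a b := by
      refine mem_scrollCone_of_minors _ fun k l hk hl => ?_
      simp only [Pi.add_apply, Pi.smul_apply, smul_eq_mul]
      obtain ⟨h1, h2⟩ := hcoef k l hk hl
      linear_combination h1 + η * h2 + (q₀ k.castSucc * q₀ l.succ - q₀ k.succ * q₀ l.castSucc) * hη
    refine ⟨_, smul_mem_scrollCone (-c / 2) (hsum 1 (by norm_num)), _, hsum (-1) (by norm_num), ?_⟩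
    ext
    simp only [pluckerVec, Pi.add_apply, Pi.smul_apply, smul_eq_mul]
    ring

theorem puncturedCone_secantVariety_subset_closure {a b : ℕ} (ha : 1 ≤ a) (hb : 1 ≤ b) :
    puncturedCone (secantVariety a b) ⊆ closure {w | ∃ p ∈ scrollCone a b, ∃ q ∈ scrollCone a b,
      w = pluckerVec p q} := by
  rintro w ⟨hw, y, p, q, h, hline, hmk⟩
  obtain ⟨c, rfl⟩ := (Projectivization.mk_eq_mk_iff' ℂ _ _ hw h).1 hmk
  rw [← pluckerVec_smul_left] at hw ⊢
  refine y.pluckerVec_mem_closure ha hb ?_ ?_ hw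
  · rw [hline]
    exact Submodule.smul_mem _ _ (Submodule.subset_span (by simp))
  · rw [hline]
    exact Submodule.subset_span (by simp)

/-- The points of the scroll with parameter `(1 : t)`, where `t ∉ T`, which lie on neither of the
two curves `u = 0` and `v = 0`. -/
def genericScroll (a b : ℕ) (T : Finset ℂ) : Set (Fin (a + b + 2) → ℂ) :=
  {p | ∃ t u v : ℂ, t ∉ T ∧ u ≠ 0 ∧ v ≠ 0 ∧ p = scrollVec a b 1 t u v}

theorem eventually_add_mul_ne_zero (x : ℂ) {y : ℂ} (hy : y ≠ 0) :
    ∀ᶠ ε in 𝓝[≠] (0 : ℂ), x + ε * y ≠ 0 := by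
  by_cases hx : x = 0
  · filter_upwards [self_mem_nhdsWithin] with ε hε
    simpa [hx, hy] using hε
  · have : ContinuousAt (fun ε : ℂ => x + ε * y) 0 := by fun_prop
    exact (this.eventually_ne (by simpa using hx)).filter_mono nhdsWithin_le_nhds

/-- All parameters are perturbed along (1, k, 1, 1). Because k ∉ T, each excluded condition is a
non-trivial affine equation in ε, so it fails for small ε ≠ 0. -/
theorem scrollCone_subset_closure_genericScroll (a b : ℕ) (T : Finset ℂ) :
    scrollCone a b ⊆ closure (genericScroll a b T) := by
  rintro _ ⟨s, t, u, v, rfl⟩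
  obtain ⟨k, hk⟩ := Infinite.exists_notMem_finset T
  have hcont : Continuous fun ε : ℂ => scrollVec a b (s + ε * 1) (t + ε * k) (u + ε * 1)
      (v + ε * 1) := by
    have : Continuous fun ε : ℂ => (s + ε * 1, t + ε * k, u + ε * 1, v + ε * 1) := by fun_prop
    exact (continuous_scrollVec a b).comp this
  have htend := (hcont.tendsto 0).mono_left (nhdsWithin_le_nhds (s := {0}ᶜ))
  simp only [zero_mul, add_zero] at htend
  refine mem_closure_of_tendsto htend ?_
  have hT : ∀ᶠ ε in 𝓝[≠] (0 : ℂ), ∀ z ∈ T, (t - z * s) + ε * (k - z) ≠ 0 :=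
    (eventually_all_finset T).2 fun z hz =>
      eventually_add_mul_ne_zero _ (sub_ne_zero.2 fun h => hk (h ▸ hz))
  filter_upwards [eventually_add_mul_ne_zero s one_ne_zero, eventually_add_mul_ne_zero u one_ne_zero,
    eventually_add_mul_ne_zero v one_ne_zero, hT] with ε hs hu hv hε
  refine ⟨_, _, _, fun hz => hε _ hz ?_, mul_ne_zero hu (pow_ne_zero a hs),
    mul_ne_zero hv (pow_ne_zero b hs), scrollVec_eq_scrollVec_one hs _ _ _⟩
  have := div_mul_cancel₀ (t + ε * k) hs
  linear_combination -this

/-- The points are moved one at a time: `p` with `q` fixed, then `q` while also avoiding the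
parameter already chosen for `p`. -/
theorem pluckerVec_mem_closure_generic {a b : ℕ} (T : Finset ℂ) {p q : Fin (a + b + 2) → ℂ}
    (hp : p ∈ scrollCone a b) (hq : q ∈ scrollCone a b) :
    pluckerVec p q ∈ closure {w | ∃ t t' u v u' v' : ℂ, t ∉ T ∧ t' ∉ T ∧ t ≠ t' ∧ u ≠ 0 ∧ v ≠ 0 ∧
      u' ≠ 0 ∧ v' ≠ 0 ∧ w = pluckerVec (scrollVec a b 1 t u v) (scrollVec a b 1 t' u' v')} := by
  have h1 : Continuous fun p => pluckerVec p q :=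
    continuous_pluckerVec.comp (Continuous.prodMk_left q)
  refine closure_minimal ?_ isClosed_closure (image_closure_subset_closure_image h1
    (Set.mem_image_of_mem _ (scrollCone_subset_closure_genericScroll a b T hp)))
  rintro _ ⟨_, ⟨t, u, v, ht, hu, hv, rfl⟩, rfl⟩
  have h2 : Continuous fun q => pluckerVec (scrollVec a b 1 t u v) q :=
    continuous_pluckerVec.comp (Continuous.prodMk_right _)
  refine closure_mono ?_ (image_closure_subset_closure_image h2
    (Set.mem_image_of_mem _ (scrollCone_subset_closure_genericScroll a b (insert t T) hq)))
  rintro _ ⟨_, ⟨t', u', v', ht', hu', hv', rfl⟩, rfl⟩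
  rw [Finset.mem_insert, not_or] at ht'
  exact ⟨t, t', u, v, u', v', ht, ht'.2, fun h => ht'.1 h.symm, hu, hv, hu', hv', rfl⟩

theorem puncturedCone_subset_closure_generic {a b : ℕ} (ha : 1 ≤ a) (hb : 1 ≤ b) (T : Finset ℂ) :
    puncturedCone (secantVariety a b) ⊆ closure {w | ∃ t t' u v u' v' : ℂ, t ∉ T ∧ t' ∉ T ∧
      t ≠ t' ∧ u ≠ 0 ∧ v ≠ 0 ∧ u' ≠ 0 ∧ v' ≠ 0 ∧
      w = pluckerVec (scrollVec a b 1 t u v) (scrollVec a b 1 t' u' v')} := by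
  refine (puncturedCone_secantVariety_subset_closure ha hb).trans
    (closure_minimal ?_ isClosed_closure)
  rintro _ ⟨p, hp, q, hq, rfl⟩
  exact pluckerVec_mem_closure_generic T hp hq

/-! ### Regular functions on the affine line and binary forms -/

/-- A function on the affine line which is everywhere locally a quotient of polynomials is a
polynomial. -/
theorem exists_polynomial_of_locally_quotient (φ : ℂ → ℂ)
    (h : ∀ t₀, ∃ A B : Polynomial ℂ, B.eval t₀ ≠ 0 ∧
      ∀ t, B.eval t ≠ 0 → φ t = A.eval t / B.eval t) :
    ∃ P : Polynomial ℂ, ∀ t, φ t = P.eval t := by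
  obtain ⟨A₀, B₀, hB₀, h₀⟩ := h 0
  have hB₀' : B₀ ≠ 0 := by rintro rfl; simp at hB₀
  obtain ⟨B, A, g, hBA, hB, hA⟩ := UniqueFactorizationMonoid.exists_reduced_factors B₀ hB₀' A₀
  have hAB : IsCoprime B A := hBA.isCoprime
  have hg : g ≠ 0 := by
    rintro rfl
    exact hB₀' (by rw [← hB, zero_mul])
  have cross (A₁ B₁ : Polynomial ℂ) (hB₁ : B₁ ≠ 0)
      (h₁ : ∀ t, B₁.eval t ≠ 0 → φ t = A₁.eval t / B₁.eval t) : A * B₁ = A₁ * B := by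
    -- Multiplying by the denominators gives an identity at every point, including their zeros; they
    -- are then cancelled as non-zero polynomials.
    have : g * B₁ * B₀ * (A * B₁ - A₁ * B) = 0 := by
      apply Polynomial.funext
      intro t
      by_cases h1 : B₁.eval t = 0
      · simp [h1]
      by_cases h0 : B₀.eval t = 0
      · simp [h0]
      have h2 := h₀ t h0
      rw [h₁ t h1, div_eq_div_iff h1 h0] at h2
      have h3 := congrArg (Polynomial.eval t) hA
      have h4 := congrArg (Polynomial.eval t) hB
      simp only [Polynomial.eval_mul, Polynomial.eval_sub, Polynomial.eval_zero] at h3 h4 ⊢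
      linear_combination B₁.eval t * B₀.eval t * (-h2 + B₁.eval t * h3 - A₁.eval t * h4)
    have h5 : g * B₁ * B₀ ≠ 0 := mul_ne_zero (mul_ne_zero hg hB₁) hB₀'
    exact sub_eq_zero.1 ((mul_eq_zero.1 this).resolve_left h5)
  have key (t : ℂ) : B.eval t ≠ 0 ∧ φ t = A.eval t / B.eval t := by
    obtain ⟨A₁, B₁, hB₁, h₁⟩ := h t
    have hc := cross A₁ B₁ (by rintro rfl; simp at hB₁) h₁
    have hdvd : B ∣ B₁ := hAB.dvd_of_dvd_mul_left ⟨A₁, by rw [hc, mul_comm]⟩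
    have hBt : B.eval t ≠ 0 := by
      obtain ⟨C, rfl⟩ := hdvd
      intro h0
      simp [h0] at hB₁
    refine ⟨hBt, ?_⟩
    have h2 := congrArg (Polynomial.eval t) hc
    simp only [Polynomial.eval_mul] at h2
    rw [h₁ t hB₁, div_eq_div_iff hB₁ hBt, h2]
  -- The reduced denominator has no zero, hence is constant.
  have hdeg : B.degree = 0 := by
    by_contra hd
    obtain ⟨t, ht⟩ := IsAlgClosed.exists_root B hd
    exact (key t).1 ht
  obtain ⟨c, hc⟩ : ∃ c, B = Polynomial.C c := ⟨_, Polynomial.eq_C_of_degree_eq_zero hdeg⟩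
  refine ⟨Polynomial.C c⁻¹ * A, fun t => ?_⟩
  rw [(key t).2, hc]
  simp [div_eq_inv_mul]

/-- A function on `ℂ² ∖ 0`, homogeneous of degree `d` and polynomial in the two standard affine
charts, is a binary form. -/
theorem exists_binaryForm_of_homogeneous (d : ℕ) (φ : ℂ → ℂ → ℂ)
    (hφ : ∀ c s t, c ≠ 0 → (s ≠ 0 ∨ t ≠ 0) → φ (c * s) (c * t) = c ^ d * φ s t)
    (P Q : Polynomial ℂ) (hP : ∀ t, φ 1 t = P.eval t) (hQ : ∀ s, φ s 1 = Q.eval s) :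
    ∃ c : ℕ → ℂ, ∀ s t, (s ≠ 0 ∨ t ≠ 0) →
      φ s t = ∑ i ∈ Finset.range (d + 1), c i * s ^ (d - i) * t ^ i := by
  have h1 (t : ℂ) (ht : t ≠ 0) : P.eval t = t ^ d * Q.eval t⁻¹ := by
    rw [← hP, ← hQ, ← hφ t t⁻¹ 1 ht (Or.inr one_ne_zero), mul_inv_cancel₀ ht, mul_one]
  -- The chart change P(t) = t^d Q(1/t), cleared of denominators. It bounds deg P by d and matches
  -- the coefficient of t^d with Q(0), which settles the point s = 0.
  have h2 : Polynomial.X ^ Q.natDegree * P = Polynomial.X ^ d * Q.reverse := by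
    apply Polynomial.eq_of_infinite_eval_eq
    refine (Set.finite_singleton (0 : ℂ)).infinite_compl.mono ?_
    intro t ht
    have ht : t ≠ 0 := ht
    have := invertibleOfNonzero (inv_ne_zero ht)
    have h3 := Polynomial.eval₂_reverse_mul_pow (RingHom.id ℂ) t⁻¹ Q
    simp only [invOf_eq_inv, inv_inv, Polynomial.eval₂_id, inv_pow] at h3
    simp only [Polynomial.eval_mul, Polynomial.eval_pow, Polynomial.eval_X, Set.mem_ofPred_eq]
    rw [h1 t ht, ← h3]
    field_simp
  have hdegP : P.natDegree ≤ d := by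
    by_cases hP0 : P = 0
    · simp [hP0]
    have h3 := congrArg Polynomial.natDegree h2
    rw [Polynomial.natDegree_mul (pow_ne_zero _ Polynomial.X_ne_zero) hP0,
      Polynomial.natDegree_X_pow] at h3
    have h4 : (Polynomial.X ^ d * Q.reverse).natDegree ≤ d + Q.reverse.natDegree := by
      simpa using Polynomial.natDegree_mul_le (p := Polynomial.X ^ d) (q := Q.reverse)
    have h5 := Polynomial.reverse_natDegree_le Q
    omega
  have hcoeff : P.coeff d = Q.coeff 0 := by
    have h3 := congrArg (fun R => Polynomial.coeff R (d + Q.natDegree)) h2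
    simp only [Polynomial.coeff_X_pow_mul] at h3
    rw [h3, add_comm, Polynomial.coeff_X_pow_mul, Polynomial.coeff_reverse,
      Polynomial.revAt_le le_rfl, Nat.sub_self]
  have hPd (t : ℂ) : P.eval t = ∑ i ∈ Finset.range (d + 1), P.coeff i * t ^ i :=
    Polynomial.eval_eq_sum_range' (by omega) t
  have hone (s t : ℂ) (hs : s ≠ 0) :
      φ s t = ∑ i ∈ Finset.range (d + 1), P.coeff i * s ^ (d - i) * t ^ i := by
    have := hφ s 1 (t / s) hs (Or.inl one_ne_zero)
    rw [mul_one, mul_div_cancel₀ _ hs, hP, hPd, Finset.mul_sum] at this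
    rw [this]
    refine Finset.sum_congr rfl fun i hi => ?_
    have hi : i ≤ d := by simpa [Nat.lt_succ_iff] using hi
    have : s ^ d = s ^ (d - i) * s ^ i := by rw [← pow_add, Nat.sub_add_cancel hi]
    rw [this, div_pow]
    field_simp
  refine ⟨P.coeff, fun s t hst => ?_⟩
  by_cases hs : s = 0
  · subst hs
    have ht : t ≠ 0 := by simpa using hst
    have h3 := hφ t 0 1 ht (Or.inr one_ne_zero)
    rw [mul_zero, mul_one, hQ, ← Polynomial.coeff_zero_eq_eval_zero, ← hcoeff] at h3
    rw [h3, Finset.sum_range_succ, Finset.sum_eq_zero]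
    · simp [mul_comm]
    · intro i hi
      rw [zero_pow (Nat.sub_ne_zero_of_lt (Finset.mem_range.1 hi))]
      simp
  · exact hone s t hs

/-- Polynomial functions of one complex variable. -/
def IsPolynomialFun (g : ℂ → ℂ) : Prop := ∃ P : Polynomial ℂ, ∀ t, g t = P.eval t

namespace IsPolynomialFun

theorem const (c : ℂ) : IsPolynomialFun fun _ => c := ⟨Polynomial.C c, by simp⟩

theorem id : IsPolynomialFun fun t => t := ⟨Polynomial.X, by simp⟩

theorem mul {g h : ℂ → ℂ} : IsPolynomialFun g → IsPolynomialFun h →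
    IsPolynomialFun fun t => g t * h t := by
  rintro ⟨P, hP⟩ ⟨Q, hQ⟩
  exact ⟨P * Q, by simp [hP, hQ]⟩

theorem sub {g h : ℂ → ℂ} : IsPolynomialFun g → IsPolynomialFun h →
    IsPolynomialFun fun t => g t - h t := by
  rintro ⟨P, hP⟩ ⟨Q, hQ⟩
  exact ⟨P - Q, by simp [hP, hQ]⟩

theorem pow {g : ℂ → ℂ} (n : ℕ) : IsPolynomialFun g → IsPolynomialFun fun t => g t ^ n := by
  rintro ⟨P, hP⟩
  exact ⟨P ^ n, by simp [hP]⟩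

theorem pluckerVec_scrollVec {a b : ℕ} {s t u v : ℂ → ℂ} (hs : IsPolynomialFun s)
    (ht : IsPolynomialFun t) (hu : IsPolynomialFun u) (hv : IsPolynomialFun v)
    (q : Fin (a + b + 2) → ℂ) (ij : PluckerIndex (a + b + 2)) :
    IsPolynomialFun fun z => pluckerVec (scrollVec a b (s z) (t z) (u z) (v z)) q ij := by
  have key (i : Fin (a + b + 2)) :
      IsPolynomialFun fun z => scrollVec a b (s z) (t z) (u z) (v z) i := by
    unfold scrollVec
    split_ifs
    · exact (hu.mul (hs.pow _)).mul (ht.pow _)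
    · exact (hv.mul (hs.pow _)).mul (ht.pow _)
  exact ((key _).mul (const _)).sub ((key _).mul (const _))

end IsPolynomialFun

/-! ### Sections of 𝒪(1): homogeneity, restriction to curves, closures -/

theorem MvPolynomial.IsHomogeneous.eval_smul {κ : Type*} {F : MvPolynomial κ ℂ} {d : ℕ}
    (hF : F.IsHomogeneous d) (c : ℂ) (w : κ → ℂ) :
    MvPolynomial.eval (c • w) F = c ^ d * MvPolynomial.eval w F := by
  rw [MvPolynomial.eval_eq, MvPolynomial.eval_eq, Finset.mul_sum]
  refine Finset.sum_congr rfl fun m hm => ?_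
  have hd : ∑ i ∈ m.support, m i = d := by
    rw [← Finsupp.degree_apply, Finsupp.degree_eq_weight_one]
    exact hF (MvPolynomial.mem_support_iff.1 hm)
  simp only [Pi.smul_apply, smul_eq_mul, mul_pow, Finset.prod_mul_distrib, Finset.prod_pow_eq_pow_sum,
    hd]
  ring

namespace IsGlobalSectionO1

theorem map_smul {κ : Type*} {X : Set (Projectivization ℂ (κ → ℂ))} {f : (κ → ℂ) → ℂ}
    (hf : IsGlobalSectionO1 X f) {w : κ → ℂ} (hw : w ∈ puncturedCone X) {c : ℂ} (hc : c ≠ 0) :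
    f (c • w) = c * f w := by
  obtain ⟨d, F, G, hF, hG, hGw, h⟩ := hf w hw
  have hF' := hF.eval_smul c w
  have hG' := hG.eval_smul c w
  rw [h _ (smul_mem_puncturedCone hw hc) (by rw [hG']; exact mul_ne_zero (pow_ne_zero d hc) hGw),
    h w hw hGw, hF', hG']
  field_simp
  ring

theorem isPolynomialFun_comp {κ : Type*} {X : Set (Projectivization ℂ (κ → ℂ))}
    {f : (κ → ℂ) → ℂ} (hf : IsGlobalSectionO1 X f) {w : ℂ → κ → ℂ}
    (hw : ∀ k, IsPolynomialFun fun t => w t k) (hwX : ∀ t, w t ∈ puncturedCone X) :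
    IsPolynomialFun fun t => f (w t) := by
  choose W hW using hw
  have heval (F : MvPolynomial κ ℂ) (t : ℂ) :
      MvPolynomial.eval (w t) F = (MvPolynomial.aeval W F).eval t := by
    have h1 := MvPolynomial.comp_aeval_apply (f := W) (Polynomial.aeval t) F
    rw [Polynomial.coe_aeval_eq_eval] at h1
    rw [h1, ← MvPolynomial.coe_aeval_eq_eval]
    have h2 : w t = fun k => (W k).eval t := funext fun k => hW k t
    rw [h2]
    rfl
  apply exists_polynomial_of_locally_quotient
  intro t₀
  obtain ⟨d, F, G, -, -, hG, h⟩ := hf (w t₀) (hwX t₀)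
  refine ⟨MvPolynomial.aeval W F, MvPolynomial.aeval W G, by rwa [← heval], fun t ht => ?_⟩
  rw [← heval] at ht ⊢
  rw [← heval]
  exact h _ (hwX t) ht

/-- With f = F / G near `w`, the polynomial condition G (F - l G) = 0 holds on `E`, hence on its
closure, and G(w) ≠ 0. The extra factor G covers the points of `E` where G vanishes. -/
theorem eq_of_mem_closure {κ : Type*} [Finite κ] {X : Set (Projectivization ℂ (κ → ℂ))}
    {f : (κ → ℂ) → ℂ} (hf : IsGlobalSectionO1 X f) (l : (κ → ℂ) →ₗ[ℂ] ℂ) {E : Set (κ → ℂ)}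
    (hE : E ⊆ puncturedCone X) (hfE : ∀ w ∈ E, f w = l w) {w : κ → ℂ} (hw : w ∈ puncturedCone X)
    (hwE : w ∈ closure E) : f w = l w := by
  obtain ⟨d, F, G, -, -, hG, h⟩ := hf w hw
  have hl : Continuous l := l.continuous_of_finiteDimensional
  have hclosed : IsClosed {w | MvPolynomial.eval w G * (MvPolynomial.eval w F -
      l w * MvPolynomial.eval w G) = 0} := by
    refine isClosed_eq ?_ continuous_const
    have := MvPolynomial.continuous_eval F
    have := MvPolynomial.continuous_eval G
    fun_prop
  have hmem := closure_minimal (fun w' hw' => ?_) hclosed hwE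
  · have h1 := (mul_eq_zero.1 hmem).resolve_left hG
    rw [h w hw hG, div_eq_iff hG]
    exact sub_eq_zero.1 h1
  · by_cases h0 : MvPolynomial.eval w' G = 0
    · simp [h0]
    · have h1 := h w' (hE hw') h0
      rw [hfE w' hw', eq_div_iff h0] at h1
      simp [h1]

end IsGlobalSectionO1

/-! ### Linear forms on the scroll and alternating forms -/

/-- The dictionary between linear forms and pairs of binary forms of degrees a and b, used in both
directions. -/
theorem sum_mul_scrollVec {a b : ℕ} (g : ℕ → ℂ) (s t u v : ℂ) :
    ∑ i : Fin (a + b + 2), g i * scrollVec a b s t u v i =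
      u * ∑ i ∈ Finset.range (a + 1), g i * s ^ (a - i) * t ^ i +
      v * ∑ j ∈ Finset.range (b + 1), g (a + 1 + j) * s ^ (b - j) * t ^ j := by
  unfold scrollVec
  rw [Fin.sum_univ_eq_sum_range (fun i => g i * (if i ≤ a then u * s ^ (a - i) * t ^ i
      else v * s ^ (a + b + 1 - i) * t ^ (i - (a + 1)))) (a + b + 2),
    show a + b + 2 = a + 1 + (b + 1) by ring, Finset.sum_range_add, Finset.mul_sum,
    Finset.mul_sum]
  congr 1
  · refine Finset.sum_congr rfl fun i hi => ?_
    rw [if_pos (Nat.lt_succ_iff.1 (Finset.mem_range.1 hi))]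
    ring
  · refine Finset.sum_congr rfl fun j hj => ?_
    rw [if_neg (by omega), Nat.add_sub_cancel_left,
      show a + b + 1 - (a + 1 + j) = b - j by omega]
    ring

theorem span_genericScroll (a b : ℕ) : Submodule.span ℂ (genericScroll a b ∅) = ⊤ := by
  by_contra h
  obtain ⟨φ, hφ0, hφ⟩ := Submodule.exists_le_ker_of_lt_top _ (lt_top_iff_ne_top.2 h)
  set g : ℕ → ℂ := fun n => if h : n < a + b + 2 then φ (Pi.single ⟨n, h⟩ 1) else 0 with hg
  have hφg (x : Fin (a + b + 2) → ℂ) : φ x = ∑ i : Fin (a + b + 2), g i * x i := by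
    rw [linearMap_apply_eq_sum_single]
    refine Finset.sum_congr rfl fun i _ => ?_
    simp only [hg, i.2, dite_true, Fin.eta]
  have hpoly (n : ℕ) (c : ℕ → ℂ) (hc : ∀ t, ∑ i ∈ Finset.range (n + 1), c i * t ^ i = 0) :
      ∀ i ≤ n, c i = 0 := by
    have h0 : ∑ i ∈ Finset.range (n + 1), Polynomial.C (c i) * Polynomial.X ^ i = 0 :=
      Polynomial.funext fun t => by simpa [Polynomial.eval_finsetSum] using hc t
    intro i hi
    have := congrArg (fun P => Polynomial.coeff P i) h0
    simpa [Polynomial.finsetSum_coeff, Nat.lt_succ_iff, hi] using this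
  have hvan (t u v : ℂ) (hu : u ≠ 0) (hv : v ≠ 0) :
      u * ∑ i ∈ Finset.range (a + 1), g i * t ^ i +
        v * ∑ j ∈ Finset.range (b + 1), g (a + 1 + j) * t ^ j = 0 := by
    have h1 : φ (scrollVec a b 1 t u v) = 0 :=
      hφ (Submodule.subset_span ⟨t, u, v, by simp, hu, hv, rfl⟩)
    rw [hφg, sum_mul_scrollVec] at h1
    simpa using h1
  -- Subtracting the relations at (u, v) = (2, 1) and (1, 1) isolates the coefficient of u without
  -- leaving the locus where u and v are non-zero.
  have h1 := hpoly a g fun t => by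
    linear_combination hvan t 2 1 (by norm_num) (by norm_num) - hvan t 1 1 (by norm_num)
      (by norm_num)
  have h2 := hpoly b (fun j => g (a + 1 + j)) fun t => by
    linear_combination hvan t 1 2 (by norm_num) (by norm_num) - hvan t 1 1 (by norm_num)
      (by norm_num)
  apply hφ0
  ext1 i
  ext
  simp only [LinearMap.coe_comp, LinearMap.coe_single, Function.comp_apply, LinearMap.zero_apply]
  rw [hφg]
  refine Finset.sum_eq_zero fun j _ => ?_
  by_cases hj : (j : ℕ) ≤ a
  · rw [h1 j hj, zero_mul]
  · have := h2 (j - (a + 1)) (by omega)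
    rw [show a + 1 + ((j : ℕ) - (a + 1)) = j by omega] at this
    rw [this, zero_mul]

theorem pluckerVec_single_single {n : ℕ} {i j : Fin n} (hij : i < j) :
    pluckerVec (Pi.single i 1) (Pi.single j 1) = Pi.single (⟨(i, j), hij⟩ : PluckerIndex n) 1 := by
  ext ⟨⟨k, l⟩, hkl⟩
  simp only [pluckerVec, Pi.single_apply, Subtype.mk.injEq, Prod.mk.injEq]
  have hkl : k < l := hkl
  by_cases h1 : k = i <;> by_cases h2 : l = j <;> by_cases h3 : l = i <;> by_cases h4 : k = j <;>
    simp_all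
  all_goals exact absurd (hij.trans hkl) (lt_irrefl _)

/-- The antisymmetrization of a bilinear form is a linear form in the Plücker coordinates. -/
theorem exists_linearMap_pluckerVec_eq_sub {n : ℕ}
    (B : (Fin n → ℂ) →ₗ[ℂ] (Fin n → ℂ) →ₗ[ℂ] ℂ) :
    ∃ l : (PluckerIndex n → ℂ) →ₗ[ℂ] ℂ, ∀ p q, l (pluckerVec p q) = B p q - B q p := by
  let e : Fin n → Fin n → ℂ := fun i => Pi.single i 1
  let l : (PluckerIndex n → ℂ) →ₗ[ℂ] ℂ := (Pi.basisFun ℂ (PluckerIndex n)).constr ℂ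
    fun ij => B (e ij.1.1) (e ij.1.2) - B (e ij.1.2) (e ij.1.1)
  have hl (i j : Fin n) (hij : i < j) :
      l (pluckerVec (e i) (e j)) = B (e i) (e j) - B (e j) (e i) := by
    rw [pluckerVec_single_single hij, ← Pi.basisFun_apply, Module.Basis.constr_basis]
  have key : (pluckerMap n).compr₂ l = B - B.flip := by
    refine LinearMap.ext_basis (Pi.basisFun ℂ (Fin n)) (Pi.basisFun ℂ (Fin n)) fun i j => ?_
    simp only [Pi.basisFun_apply, LinearMap.compr₂_apply, pluckerMap_apply, LinearMap.sub_apply,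
      LinearMap.flip_apply]
    rcases lt_trichotomy i j with hij | rfl | hij
    · exact hl i j hij
    · rw [pluckerVec_self, map_zero, sub_self]
    · rw [pluckerVec_swap, map_neg, hl j i hij]
      ring
  exact ⟨l, fun p q => by simpa using congrArg (fun φ => φ p q) key⟩

/-! ### Linearity of a section in each point of a secant -/

/-- The second point is off the directrix v = 0 because v' ≠ 0. No condition on (s : t) is needed,
so the whole of ℙ¹ is available. -/
theorem pluckerVec_scrollVec_fst_ne_zero {a b : ℕ} {s t t' u' v' : ℂ} (hst : s ≠ 0 ∨ t ≠ 0)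
    (hv' : v' ≠ 0) :
    pluckerVec (scrollVec a b s t 1 0) (scrollVec a b 1 t' u' v') ≠ 0 := by
  intro h
  rw [pluckerVec_eq_zero_iff_minors] at h
  have h0 := h ⟨0, by omega⟩ ⟨a + 1, by omega⟩
  have h1 := h ⟨a, by omega⟩ ⟨a + 1, by omega⟩
  simp [scrollVec, hv'] at h0 h1
  rcases hst with hs | ht
  · exact hs h0.1
  · exact ht h1.1

theorem pluckerVec_scrollVec_snd_ne_zero {a b : ℕ} {s t t' u' v' : ℂ} (hst : s ≠ 0 ∨ t ≠ 0)
    (hu' : u' ≠ 0) :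
    pluckerVec (scrollVec a b s t 0 1) (scrollVec a b 1 t' u' v') ≠ 0 := by
  intro h
  rw [pluckerVec_eq_zero_iff_minors] at h
  have h0 := h ⟨a + 1, by omega⟩ ⟨0, by omega⟩
  have h1 := h ⟨a + b + 1, by omega⟩ ⟨0, by omega⟩
  simp [scrollVec, hu'] at h0 h1
  rcases hst with hs | ht
  · exact hs h0.1
  · exact ht h1.1

theorem pluckerVec_scrollVec_ne_zero {a b : ℕ} (ha : 1 ≤ a) (hb : 1 ≤ b) {t t' u v u' v' : ℂ}
    (ht : t ≠ t') (huv : u ≠ 0 ∨ v ≠ 0) (hu' : u' ≠ 0) (hv' : v' ≠ 0) :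
    pluckerVec (scrollVec a b 1 t u v) (scrollVec a b 1 t' u' v') ≠ 0 := by
  intro h
  rw [pluckerVec_eq_zero_iff_minors] at h
  have h0 := h ⟨0, by omega⟩ ⟨1, by omega⟩
  have h1 := h ⟨a + 1, by omega⟩ ⟨a + 2, by omega⟩
  simp [scrollVec, ha] at h0 h1
  have ht' := sub_ne_zero.2 ht
  rcases huv with hu | hv
  · exact mul_ne_zero (mul_ne_zero hu hu') ht' (by linear_combination -h0)
  · exact mul_ne_zero (mul_ne_zero hv hv') ht' (by linear_combination -h1)

namespace IsGlobalSectionO1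

variable {a b : ℕ} {f : (PluckerIndex (a + b + 2) → ℂ) → ℂ}

theorem map_pluckerVec_swap (hf : IsGlobalSectionO1 (secantVariety a b) f)
    {p q : Fin (a + b + 2) → ℂ} (hp : p ∈ scrollCone a b) (hq : q ∈ scrollCone a b)
    (h : pluckerVec p q ≠ 0) : f (pluckerVec q p) = -f (pluckerVec p q) := by
  have := hf.map_smul (pluckerVec_mem_puncturedCone hp hq h) (c := -1) (by norm_num)
  rw [pluckerVec_swap, ← neg_one_smul ℂ, this, neg_one_mul]

/-- For a fixed general point `q` of the scroll, `p ↦ f (p ∧ q)` is the restriction of a linear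
form to the part of the scroll away from the ruling through `q`. -/
theorem exists_linearMap_fixed_right (ha : 1 ≤ a) (hb : 1 ≤ b)
    (hf : IsGlobalSectionO1 (secantVariety a b) f) {t' u' v' : ℂ} (hu' : u' ≠ 0) (hv' : v' ≠ 0) :
    ∃ L : (Fin (a + b + 2) → ℂ) →ₗ[ℂ] ℂ, ∀ t u v, t ≠ t' → (u ≠ 0 ∨ v ≠ 0) →
      f (pluckerVec (scrollVec a b 1 t u v) (scrollVec a b 1 t' u' v')) =
        L (scrollVec a b 1 t u v) := by
  set q := scrollVec a b 1 t' u' v' with hq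
  have hmem {s t u v : ℂ} (h : pluckerVec (scrollVec a b s t u v) q ≠ 0) :=
    pluckerVec_mem_puncturedCone (scrollVec_mem_scrollCone s t u v)
      (scrollVec_mem_scrollCone 1 t' u' v') h
  have hmul {s t u v : ℂ} (h : pluckerVec (scrollVec a b s t u v) q ≠ 0) {c : ℂ} (hc : c ≠ 0) :
      f (pluckerVec (scrollVec a b s t (c * u) (c * v)) q) =
        c * f (pluckerVec (scrollVec a b s t u v) q) := by
    rw [scrollVec_smul, pluckerVec_smul_left, hf.map_smul (hmem h) hc]
  -- The torus weights of u and v: they give the degrees a and b of the binary forms below.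
  have hpow (c s t u v : ℂ) : scrollVec a b (c * s) (c * t) u v =
      scrollVec a b s t (c ^ a * u) (c ^ b * v) := by
    ext i
    have hi := i.2
    simp only [scrollVec, mul_pow]
    split_ifs with h
    · rw [show c ^ a = c ^ (a - i) * c ^ (i : ℕ) by rw [← pow_add, Nat.sub_add_cancel h]]
      ring
    · rw [show c ^ b = c ^ (a + b + 1 - i) * c ^ ((i : ℕ) - (a + 1)) by
        rw [← pow_add]; congr 1; omega]
      ring
  have hpoly {s t u v : ℂ → ℂ} (hs : IsPolynomialFun s) (ht : IsPolynomialFun t)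
      (hu : IsPolynomialFun u) (hv : IsPolynomialFun v)
      (h : ∀ z, pluckerVec (scrollVec a b (s z) (t z) (u z) (v z)) q ≠ 0) :=
    hf.isPolynomialFun_comp (hs.pluckerVec_scrollVec ht hu hv q) fun z => hmem (h z)
  have hid := IsPolynomialFun.id
  have hc := IsPolynomialFun.const
  obtain ⟨α, hα⟩ : ∃ α : ℕ → ℂ, ∀ s t, (s ≠ 0 ∨ t ≠ 0) →
      f (pluckerVec (scrollVec a b s t 1 0) q) =
        ∑ i ∈ Finset.range (a + 1), α i * s ^ (a - i) * t ^ i := by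
    obtain ⟨P, hP⟩ := hpoly (hc 1) hid (hc 1) (hc 0) fun z =>
      pluckerVec_scrollVec_fst_ne_zero (Or.inl one_ne_zero) hv'
    obtain ⟨Q, hQ⟩ := hpoly hid (hc 1) (hc 1) (hc 0) fun z =>
      pluckerVec_scrollVec_fst_ne_zero (Or.inr one_ne_zero) hv'
    refine exists_binaryForm_of_homogeneous a _ (fun c s t hc hst => ?_) P Q hP hQ
    rw [hpow, ← hmul (pluckerVec_scrollVec_fst_ne_zero hst hv') (pow_ne_zero a hc), mul_zero,
      mul_zero]
  obtain ⟨β, hβ⟩ : ∃ β : ℕ → ℂ, ∀ s t, (s ≠ 0 ∨ t ≠ 0) →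
      f (pluckerVec (scrollVec a b s t 0 1) q) =
        ∑ i ∈ Finset.range (b + 1), β i * s ^ (b - i) * t ^ i := by
    obtain ⟨P, hP⟩ := hpoly (hc 1) hid (hc 0) (hc 1) fun z =>
      pluckerVec_scrollVec_snd_ne_zero (Or.inl one_ne_zero) hu'
    obtain ⟨Q, hQ⟩ := hpoly hid (hc 1) (hc 0) (hc 1) fun z =>
      pluckerVec_scrollVec_snd_ne_zero (Or.inr one_ne_zero) hu'
    refine exists_binaryForm_of_homogeneous b _ (fun c s t hc hst => ?_) P Q hP hQ
    rw [hpow, ← hmul (pluckerVec_scrollVec_snd_ne_zero hst hu') (pow_ne_zero b hc), mul_zero,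
      mul_zero]
  let g : ℕ → ℂ := fun n => if n ≤ a then α n else β (n - (a + 1))
  refine ⟨∑ i : Fin (a + b + 2), g i • LinearMap.proj i, fun t u v ht huv => ?_⟩
  have hL : (∑ i : Fin (a + b + 2), g i • LinearMap.proj (R := ℂ) (φ := fun _ => ℂ) i)
      (scrollVec a b 1 t u v) = u * f (pluckerVec (scrollVec a b 1 t 1 0) q) +
        v * f (pluckerVec (scrollVec a b 1 t 0 1) q) := by
    rw [hα 1 t (Or.inl one_ne_zero), hβ 1 t (Or.inl one_ne_zero)]
    simp only [LinearMap.sum_apply, LinearMap.smul_apply, LinearMap.proj_apply, smul_eq_mul]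
    rw [sum_mul_scrollVec]
    congr 2
    · refine Finset.sum_congr rfl fun i hi => ?_
      simp [g, Nat.lt_succ_iff.1 (Finset.mem_range.1 hi)]
    · refine Finset.sum_congr rfl fun i _ => ?_
      simp only [g]
      rw [if_neg (by omega), Nat.add_sub_cancel_left]
  rw [hL]
  -- On the ruling over t ≠ t' the function of (u, v) is homogeneous of degree 1 and polynomial in
  -- both charts, hence linear.
  obtain ⟨P, hP⟩ := hpoly (hc 1) (hc t) (hc 1) hid fun z =>
    pluckerVec_scrollVec_ne_zero ha hb ht (Or.inl one_ne_zero) hu' hv'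
  obtain ⟨Q, hQ⟩ := hpoly (hc 1) (hc t) hid (hc 1) fun z =>
    pluckerVec_scrollVec_ne_zero ha hb ht (Or.inr one_ne_zero) hu' hv'
  obtain ⟨γ, hγ⟩ := exists_binaryForm_of_homogeneous 1
    (fun u v => f (pluckerVec (scrollVec a b 1 t u v) q)) (fun c u v hc huv => by
      rw [hmul (pluckerVec_scrollVec_ne_zero ha hb ht huv hu' hv') hc, pow_one]) P Q hP hQ
  rw [hγ u v huv, hγ 1 0 (Or.inl one_ne_zero), hγ 0 1 (Or.inr one_ne_zero)]
  simp [Finset.sum_range_succ]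
  ring

theorem exists_linearMap_generic (ha : 1 ≤ a) (hb : 1 ≤ b)
    (hf : IsGlobalSectionO1 (secantVariety a b) f) :
    ∃ (T : Finset ℂ) (l : (PluckerIndex (a + b + 2) → ℂ) →ₗ[ℂ] ℂ), ∀ t t' u v u' v' : ℂ,
      t ∉ T → t' ∉ T → t ≠ t' → u ≠ 0 → v ≠ 0 → u' ≠ 0 → v' ≠ 0 →
      f (pluckerVec (scrollVec a b 1 t u v) (scrollVec a b 1 t' u' v')) =
        l (pluckerVec (scrollVec a b 1 t u v) (scrollVec a b 1 t' u' v')) := by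
  classical
  have hspan := (span_genericScroll a b).ge
  set e := Module.Basis.ofSpan hspan with he
  have := FiniteDimensional.fintypeBasisIndex e
  have hmem (j) : e j ∈ genericScroll a b ∅ :=
    Module.Basis.ofSpan_subset hspan (Set.mem_range_self j)
  choose τ μ ν _ hμ hν hej using hmem
  choose L hL using fun j => hf.exists_linearMap_fixed_right ha hb (t' := τ j) (hμ j) (hν j)
  -- B(p, q) = Σ e_j*(p) L_j(q) with L_j(q) = f(q ∧ e_j) off the ruling through e_j. Thus -B(p, q)
  -- recovers f(p ∧ q), linear in p, from its values at the basis; q must avoid the rulings over `τ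
  -- j`.
  let B : (Fin (a + b + 2) → ℂ) →ₗ[ℂ] (Fin (a + b + 2) → ℂ) →ₗ[ℂ] ℂ :=
    ∑ j, (e.coord j).smulRight (L j)
  have hB {t t' u v u' v' : ℂ} (ht' : t' ∉ Finset.univ.image τ) (htt' : t ≠ t') (hu : u ≠ 0)
      (hu' : u' ≠ 0) (hv' : v' ≠ 0) :
      f (pluckerVec (scrollVec a b 1 t u v) (scrollVec a b 1 t' u' v')) =
        -B (scrollVec a b 1 t u v) (scrollVec a b 1 t' u' v') := by
    obtain ⟨M, hM⟩ := hf.exists_linearMap_fixed_right ha hb (t' := t') hu' hv'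
    rw [hM t u v htt' (Or.inl hu)]
    conv_lhs => rw [← e.sum_repr (scrollVec a b 1 t u v)]
    simp only [B, map_sum, LinearMap.sum_apply, LinearMap.smulRight_apply, _root_.map_smul,
      LinearMap.smul_apply, Module.Basis.coord_apply, smul_eq_mul]
    rw [← Finset.sum_neg_distrib]
    refine Finset.sum_congr rfl fun j _ => ?_
    have hj : τ j ≠ t' := fun h => ht' (h ▸ Finset.mem_image_of_mem τ (Finset.mem_univ j))
    rw [← hL j t' u' v' hj.symm (Or.inl hu'), hej j, ← hM _ _ _ hj (Or.inl (hμ j)),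
      hf.map_pluckerVec_swap (scrollVec_mem_scrollCone ..) (scrollVec_mem_scrollCone ..)
        (pluckerVec_scrollVec_ne_zero ha hb hj.symm (Or.inl hu') (hμ j) (hν j))]
    ring
  obtain ⟨l, hl⟩ := exists_linearMap_pluckerVec_eq_sub B
  -- For general p and q, l(p ∧ q) = B(p, q) - B(q, p) = -2 f(p ∧ q).
  refine ⟨Finset.univ.image τ, (-1 / 2 : ℂ) • l, fun t t' u v u' v' ht ht' htt' hu hv hu' hv' => ?_⟩
  have h1 := hB (v := v) ht' htt' hu hu' hv'
  have h2 := hB (v := v') ht htt'.symm hu' hu hv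
  rw [hf.map_pluckerVec_swap (scrollVec_mem_scrollCone ..) (scrollVec_mem_scrollCone ..)
    (pluckerVec_scrollVec_ne_zero ha hb htt' (Or.inl hu) hu' hv')] at h2
  rw [LinearMap.smul_apply, hl, smul_eq_mul]
  linear_combination (1 / 2) * h1 - (1 / 2) * h2

end IsGlobalSectionO1

/-! ### Linear normality, non-degeneracy and the dimension count -/

theorem isLinearlyNormal_secantVariety {a b : ℕ} (ha : 1 ≤ a) (hb : 1 ≤ b) :
    IsLinearlyNormal (secantVariety a b) := by
  intro f hf
  obtain ⟨T, l, hl⟩ := hf.exists_linearMap_generic ha hb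
  refine ⟨l, fun w hw => hf.eq_of_mem_closure l ?_ ?_ hw
    (puncturedCone_subset_closure_generic ha hb T hw)⟩
  · rintro _ ⟨t, t', u, v, u', v', -, -, htt', hu, -, hu', hv', rfl⟩
    exact pluckerVec_mem_puncturedCone (scrollVec_mem_scrollCone ..)
      (scrollVec_mem_scrollCone ..) (pluckerVec_scrollVec_ne_zero ha hb htt' (Or.inl hu) hu' hv')
  · rintro _ ⟨t, t', u, v, u', v', ht, ht', htt', hu, hv, hu', hv', rfl⟩
    exact hl t t' u v u' v' ht ht' htt' hu hv hu' hv'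

theorem span_secantVariety (a b : ℕ) :
    Projectivization.Subspace.span (secantVariety a b) = ⊤ := by
  set W := Projectivization.Subspace.submodule
    (Projectivization.Subspace.span (secantVariety a b)) with hW
  suffices W = ⊤ by
    apply Projectivization.Subspace.submodule.injective
    rw [← hW, this, OrderIso.map_top]
  by_contra h
  obtain ⟨φ, hφ0, hφ⟩ := Submodule.exists_le_ker_of_lt_top _ (lt_top_iff_ne_top.2 h)
  have hvan (p q : Fin (a + b + 2) → ℂ) (hp : p ∈ scrollCone a b) (hq : q ∈ scrollCone a b) :
      φ (pluckerVec p q) = 0 := by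
    by_cases h0 : pluckerVec p q = 0
    · rw [h0, map_zero]
    · exact hφ ((Projectivization.Subspace.mem_submodule_iff _ h0).2
        (Projectivization.Subspace.subset_span _ (mk_pluckerVec_mem_secantVariety hp hq h0)))
  have hcone : genericScroll a b ∅ ⊆ scrollCone a b := by
    rintro _ ⟨t, u, v, -, -, -, rfl⟩
    exact scrollVec_mem_scrollCone ..
  -- A bilinear form vanishing on pairs from a spanning set is zero, and the wedges of standard
  -- basis vectors are the coordinate vectors of the Plücker space.
  have hzero : (pluckerMap (a + b + 2)).compr₂ φ = 0 := by
    refine LinearMap.ext_on (span_genericScroll a b) fun p hp => ?_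
    refine LinearMap.ext_on (span_genericScroll a b) fun q hq => ?_
    exact hvan p q (hcone hp) (hcone hq)
  apply hφ0
  refine (Pi.basisFun ℂ (PluckerIndex (a + b + 2))).ext fun ⟨⟨i, j⟩, hij⟩ => ?_
  rw [Pi.basisFun_apply, ← pluckerVec_single_single hij]
  exact congrArg (fun ψ => ψ (Pi.single i 1) (Pi.single j 1)) hzero

theorem card_pluckerIndex (n : ℕ) : Fintype.card (PluckerIndex n) = n.choose 2 := by
  let e : PluckerIndex n ≃ Σ j : Fin n, {i : Fin n // i < j} :=
    { toFun := fun ij => ⟨ij.1.2, ij.1.1, ij.2⟩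
      invFun := fun x => ⟨(x.2.1, x.1), x.2.2⟩
      left_inv := fun _ => rfl
      right_inv := fun _ => rfl }
  rw [Fintype.card_congr e, Fintype.card_sigma]
  simp only [Fintype.card_subtype, Finset.filter_gt_eq_Iio, Fin.card_Iio]
  rw [Fin.sum_univ_eq_sum_range (fun i => i), Finset.sum_range_id, Nat.choose_two_right]

theorem mainTheorem7 (a b r : ℕ) (ha : 1 ≤ a) (hab : a ≤ b) (hr : a + b = r) :
    Module.finrank ℂ (PluckerIndex (a + b + 2) → ℂ) = r * (r + 3) / 2 + 1 ∧
    Projectivization.Subspace.span (secantVariety a b) = ⊤ ∧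
    IsLinearlyNormal (secantVariety a b) := by
  refine ⟨?_, span_secantVariety a b, isLinearlyNormal_secantVariety ha (ha.trans hab)⟩
  rw [Module.finrank_fintype_fun_eq_card, card_pluckerIndex, hr, Nat.choose_two_right,
    show (r + 2) * (r + 2 - 1) = r * (r + 3) + 1 * 2 by
      rw [show r + 2 - 1 = r + 1 by omega]; ring,
    Nat.add_mul_div_right _ _ two_pos]
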